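/- Let $\mathcal{W}=W(2,2)$ be the complex Lie algebra with basis $\{L_n, W_n, z \mid n\in\mathbb{Z}\}$ and brackets $$[L_n,L_m]=(m-n)L_{m+n}+\tfrac{n^3-n}{12}\,\delta_{m+n,0}\,z,\qquad [L_n,W_m]=(m-n)W_{m+n}+\tfrac{n^3-n}{12}\,\delta_{m+n,0}\,z,\qquad [W_n,W_m]=[z,W_m]=[z,L_m]=0,$$ and let $\mathcal{W}_+$ be the subalgebra spanned by the $L_n, W_n$ with $n>0$. Let $\varphi:\mathcal{W}_+\to\mathbb{C}$ be a Lie algebra homomorphism that is non-singular, i.e. $\varphi(L_i)\varphi(W_i)\neq 0$ for $i=1,2$. Let $\mathbb{C}_\varphi$ be the one-dimensional $\mathcal{W}_+$-module $\mathbb{C}$ on which $x\in\mathcal{W}_+$ acts as multiplication by $\varphi(x)$, let $M_\varphi=\mathcal{U}(\mathcal{W})\otimes_{\mathcal{U}(\mathcal{W}_+)}\mathbb{C}_\varphi$ be the induced $\mathcal{W}$-module, where $\mathcal{U}$ denotes the universal enveloping algebra, and put $w=1\otimes 1\in M_\varphi$. **Proposition 3.1.** If $w'\in M_\varphi$ is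 a Whittaker vector of type $\varphi$, that is, $xw'=\varphi(x)w'$ for all $x\in\mathcal{W}_+$, then $w'=p(z)w$ for some polynomial $p(z)\in\mathbb{C}[z]\subset\mathcal{U}(\mathcal{W})$. -/

import Mathlib

open scoped TensorProduct

noncomputable section

/-- The index set of the standard basis `{L n, W n, z | n ∈ ℤ}` of `W(2,2)`. -/
inductive W22Gen : Type
  | L (n : ℤ) : W22Gen
  | W (n : ℤ) : W22Gen
  | z : W22Gen

/-- The underlying complex vector space of `W(2,2)`, with basis `{L n, W n, z | n ∈ ℤ}`. -/
def W22 : Type := W22Gen →₀ ℂ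

namespace W22

instance : AddCommGroup W22 := inferInstanceAs (AddCommGroup (W22Gen →₀ ℂ))
instance : Module ℂ W22 := inferInstanceAs (Module ℂ (W22Gen →₀ ℂ))

/-- The standard basis. -/
def basis : Module.Basis W22Gen ℂ W22 := Module.Basis.ofRepr (LinearEquiv.refl ℂ (W22Gen →₀ ℂ))

/-- The basis vector `L n`. -/
def L (n : ℤ) : W22 := basis (W22Gen.L n)

/-- The basis vector `W n`. -/
def W (n : ℤ) : W22 := basis (W22Gen.W n)

/-- The central basis vector `z`. -/
def z : W22 := basis W22Gen.z

/-- The coefficient `(n ^ 3 - n) / 12 * δ_{m + n, 0}` of `z`. -/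
def cocycle (n m : ℤ) : ℂ := if m + n = 0 then ((n : ℂ) ^ 3 - (n : ℂ)) / 12 else 0

/-- The bracket of two basis vectors; the bracket of `W n` and `L m` is minus that of
`L m` and `W n`. -/
def genBracket : W22Gen → W22Gen → W22
  | .L n, .L m => ((m : ℂ) - (n : ℂ)) • L (m + n) + cocycle n m • z
  | .L n, .W m => ((m : ℂ) - (n : ℂ)) • W (m + n) + cocycle n m • z
  | .W n, .L m => -(((n : ℂ) - (m : ℂ)) • W (n + m) + cocycle m n • z)
  | .W _, .W _ => 0
  | .z, _ => 0
  | _, .z => 0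

/-- The bilinear extension of `genBracket`. -/
def bracketHom : W22 →ₗ[ℂ] W22 →ₗ[ℂ] W22 :=
  basis.constr ℂ fun a => basis.constr ℂ fun b => genBracket a b

theorem bracketHom_basis (a b : W22Gen) :
    bracketHom (basis a) (basis b) = genBracket a b := by
  simp [bracketHom, Module.Basis.constr_basis]

theorem bracketHom_skew (x y : W22) : bracketHom x y = -bracketHom y x := by
  have h : bracketHom = -bracketHom.flip := by
    refine basis.ext fun a => basis.ext fun b => ?_
    simp only [LinearMap.neg_apply, LinearMap.flip_apply, bracketHom_basis]
    rcases a with n | n | _ <;> rcases b with m | m | _ <;>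
      simp only [genBracket, neg_zero, neg_neg]
    rw [add_comm m n, neg_add, ← neg_smul, ← neg_smul]
    congr 2
    · ring
    · unfold cocycle
      by_cases hmn : m + n = 0
      · obtain rfl : m = -n := by omega
        simp
        ring
      · rw [if_neg hmn, if_neg (by omega), neg_zero]
  exact congrArg (fun f => f x y) h

theorem bracketHom_self (x : W22) : bracketHom x x = 0 := by
  have h := bracketHom_skew x x
  have h2 : (2 : ℂ) • bracketHom x x = 0 := by
    rw [two_smul]
    nth_rewrite 1 [h]
    exact neg_add_cancel _
  exact (smul_eq_zero.mp h2).resolve_left two_ne_zero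

theorem cocycle_jacobi (a b c : ℤ) :
    ((c : ℂ) - b) * cocycle a (c + b) =
      ((b : ℂ) - a) * cocycle (b + a) c + ((c : ℂ) - a) * cocycle b (c + a) := by
  unfold cocycle
  by_cases h : c + b + a = 0
  · obtain rfl : c = -b - a := by omega
    rw [if_pos (by omega), if_pos (by omega), if_pos (by omega)]
    push_cast
    ring
  · rw [if_neg (by omega), if_neg (by omega), if_neg (by omega)]
    ring

theorem bracketHom_L_L (n m : ℤ) :
    bracketHom (L n) (L m) = ((m : ℂ) - (n : ℂ)) • L (m + n) + cocycle n m • z :=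
  bracketHom_basis _ _

theorem bracketHom_L_W (n m : ℤ) :
    bracketHom (L n) (W m) = ((m : ℂ) - (n : ℂ)) • W (m + n) + cocycle n m • z :=
  bracketHom_basis _ _

theorem bracketHom_W_W (n m : ℤ) : bracketHom (W n) (W m) = 0 := bracketHom_basis _ _

theorem bracketHom_z_left (x : W22) : bracketHom z x = 0 := by
  have h : bracketHom z = 0 := by
    refine basis.ext fun b => ?_
    rw [z, bracketHom_basis]
    rfl
  rw [h, LinearMap.zero_apply]

theorem bracketHom_z_right (x : W22) : bracketHom x z = 0 := by
  rw [bracketHom_skew, bracketHom_z_left, neg_zero]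

/-- The Jacobi identity, in the form in which `bracketHom` is a derivation. -/
def Jac (x y w : W22) : Prop :=
  bracketHom x (bracketHom y w) =
    bracketHom (bracketHom x y) w + bracketHom y (bracketHom x w)

theorem Jac.swap {x y w : W22} (h : Jac x y w) : Jac y x w := by
  unfold Jac at h ⊢
  rw [h, bracketHom_skew y x, map_neg, LinearMap.neg_apply, neg_add_cancel_left]

theorem Jac.rot {x y w : W22} (h : Jac x y w) : Jac x w y := by
  unfold Jac at h ⊢
  rw [bracketHom_skew w y, map_neg, h, bracketHom_skew (bracketHom x w) y,
    bracketHom_skew w (bracketHom x y)]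
  abel

theorem jac_L_L_L (a b c : ℤ) : Jac (L a) (L b) (L c) := by
  simp only [Jac, bracketHom_L_L, map_add, map_smul, LinearMap.add_apply, LinearMap.smul_apply,
    bracketHom_z_left, bracketHom_z_right, smul_zero, add_zero, smul_add, smul_smul]
  have e1 : c + (b + a) = c + b + a := by ring
  have e2 : c + a + b = c + b + a := by ring
  rw [e1, e2, cocycle_jacobi]
  push_cast
  module

theorem jac_L_L_W (a b c : ℤ) : Jac (L a) (L b) (W c) := by
  simp only [Jac, bracketHom_L_L, bracketHom_L_W, map_add, map_smul, LinearMap.add_apply,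
    LinearMap.smul_apply,
    bracketHom_z_left, bracketHom_z_right, smul_zero, add_zero, smul_add, smul_smul]
  have e1 : c + (b + a) = c + b + a := by ring
  have e2 : c + a + b = c + b + a := by ring
  rw [e1, e2, cocycle_jacobi]
  push_cast
  module

theorem jac_L_W_W (a b c : ℤ) : Jac (L a) (W b) (W c) := by
  simp only [Jac, bracketHom_L_W, bracketHom_W_W, map_add, map_smul, LinearMap.add_apply,
    LinearMap.smul_apply, map_zero,
    bracketHom_z_left, bracketHom_z_right, smul_zero, add_zero]

theorem jac_W_W_W (a b c : ℤ) : Jac (W a) (W b) (W c) := by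
  simp only [Jac, bracketHom_W_W, map_zero, LinearMap.zero_apply, add_zero]

theorem jac_z (x y : W22) : Jac z x y := by
  simp only [Jac, bracketHom_z_left, map_zero, LinearMap.zero_apply, add_zero]

theorem jac_basis (a b c : W22Gen) : Jac (basis a) (basis b) (basis c) := by
  rcases a with a | a | _
  · rcases b with b | b | _
    · rcases c with c | c | _
      · exact jac_L_L_L a b c
      · exact jac_L_L_W a b c
      · exact (jac_z _ _).swap.rot
    · rcases c with c | c | _
      · exact (jac_L_L_W a c b).rot
      · exact jac_L_W_W a b c
      · exact (jac_z _ _).swap.rot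
    · exact (jac_z _ _).swap
  · rcases b with b | b | _
    · rcases c with c | c | _
      · exact (jac_L_L_W b c a).rot.swap
      · exact (jac_L_W_W b a c).swap
      · exact (jac_z _ _).swap.rot
    · rcases c with c | c | _
      · exact (jac_L_W_W c a b).swap.rot
      · exact jac_W_W_W a b c
      · exact (jac_z _ _).swap.rot
    · exact (jac_z _ _).swap
  · exact jac_z _ _

theorem basis_induction {p : W22 → Prop} (hb : ∀ a, p (basis a)) (h0 : p 0)
    (hadd : ∀ x y, p x → p y → p (x + y)) (hsmul : ∀ (t : ℂ) x, p x → p (t • x)) (x : W22) :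
    p x := by
  refine Submodule.span_induction (p := fun x _ => p x) ?_ h0 (fun x y _ _ => hadd x y)
    (fun t x _ => hsmul t x) (basis.mem_span x)
  rintro _ ⟨a, rfl⟩
  exact hb a

theorem bracketHom_jacobi (x y w : W22) : Jac x y w := by
  refine basis_induction (p := fun x => Jac x y w) (fun a => ?_) ?_ ?_ ?_ x
  · refine basis_induction (p := fun y => Jac (basis a) y w) (fun b => ?_) ?_ ?_ ?_ y
    · refine basis_induction (p := fun w => Jac (basis a) (basis b) w) (jac_basis a b) ?_ ?_ ?_ w
      · simp [Jac]
      · intro x y hx hy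
        simp only [Jac, map_add] at hx hy ⊢
        rw [hx, hy]
        abel
      · intro t x hx
        simp only [Jac, map_smul] at hx ⊢
        rw [hx, smul_add]
    · simp [Jac]
    · intro x y hx hy
      simp only [Jac, map_add, LinearMap.add_apply] at hx hy ⊢
      rw [hx, hy]
      abel
    · intro t x hx
      simp only [Jac, map_smul, LinearMap.smul_apply] at hx ⊢
      rw [hx, smul_add]
  · simp [Jac]
  · intro x y hx hy
    simp only [Jac, map_add, LinearMap.add_apply] at hx hy ⊢
    rw [hx, hy]
    abel
  · intro t x hx
    simp only [Jac, map_smul, LinearMap.smul_apply] at hx ⊢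
    rw [hx, smul_add]

/-- `W(2,2)` as a Lie ring. -/
instance : LieRing W22 where
  bracket x y := bracketHom x y
  add_lie x y w := by simp
  lie_add x y w := by simp
  lie_self x := bracketHom_self x
  leibniz_lie x y w := bracketHom_jacobi x y w

/-- `W(2,2)` as a complex Lie algebra. -/
instance : LieAlgebra ℂ W22 where
  lie_smul t x y := (bracketHom x).map_smul t y

theorem lie_L_L (n m : ℤ) :
    ⁅L n, L m⁆ = ((m : ℂ) - (n : ℂ)) • L (m + n) + cocycle n m • z := bracketHom_basis _ _

theorem lie_L_W (n m : ℤ) :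
    ⁅L n, W m⁆ = ((m : ℂ) - (n : ℂ)) • W (m + n) + cocycle n m • z := bracketHom_basis _ _

theorem lie_W_L (n m : ℤ) :
    ⁅W n, L m⁆ = -(((n : ℂ) - (m : ℂ)) • W (n + m) + cocycle m n • z) := bracketHom_basis _ _

theorem lie_W_W (n m : ℤ) : ⁅W n, W m⁆ = 0 := bracketHom_basis _ _

/-- The basis vectors of positive degree. -/
def posGens : Set W22 := {x | ∃ n : ℤ, 0 < n ∧ (x = L n ∨ x = W n)}

theorem lie_posGens_mem {x y : W22} (hx : x ∈ posGens) (hy : y ∈ posGens) :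
    ⁅x, y⁆ ∈ Submodule.span ℂ posGens := by
  obtain ⟨n, hn, hx⟩ := hx
  obtain ⟨m, hm, hy⟩ := hy
  have h0 : cocycle n m = 0 := if_neg (by omega)
  have h0' : cocycle m n = 0 := if_neg (by omega)
  have hL : L (m + n) ∈ Submodule.span ℂ posGens :=
    Submodule.subset_span ⟨m + n, by omega, Or.inl rfl⟩
  have hW : W (m + n) ∈ Submodule.span ℂ posGens :=
    Submodule.subset_span ⟨m + n, by omega, Or.inr rfl⟩
  rcases hx with rfl | rfl <;> rcases hy with rfl | rfl
  · rw [lie_L_L, h0, zero_smul, add_zero]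
    exact Submodule.smul_mem _ _ hL
  · rw [lie_L_W, h0, zero_smul, add_zero]
    exact Submodule.smul_mem _ _ hW
  · rw [lie_W_L, h0', zero_smul, add_zero, add_comm n m]
    exact Submodule.neg_mem _ (Submodule.smul_mem _ _ hW)
  · rw [lie_W_W]
    exact Submodule.zero_mem _

/-- The subalgebra `W(2,2)₊`, spanned by the `L n` and `W n` with `n > 0`. -/
def pos : LieSubalgebra ℂ W22 where
  toSubmodule := Submodule.span ℂ posGens
  lie_mem' := by
    intro x y hx hy
    refine Submodule.span_induction₂ (p := fun x y _ _ => ⁅x, y⁆ ∈ Submodule.span ℂ posGens)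
      (fun x y hx hy => lie_posGens_mem hx hy) ?_ ?_ ?_ ?_ ?_ ?_ hx hy
    · intro y _
      rw [zero_lie]
      exact Submodule.zero_mem _
    · intro x _
      rw [lie_zero]
      exact Submodule.zero_mem _
    · intro x y w _ _ _ h1 h2
      rw [add_lie]
      exact Submodule.add_mem _ h1 h2
    · intro x y w _ _ _ h1 h2
      rw [lie_add]
      exact Submodule.add_mem _ h1 h2
    · intro t x y _ _ h
      rw [smul_lie]
      exact Submodule.smul_mem _ _ h
    · intro t x y _ _ h
      rw [lie_smul]
      exact Submodule.smul_mem _ _ h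

/-- `L n` with `n > 0`, as an element of `W(2,2)₊`. -/
def posL (n : ℤ) (hn : 0 < n) : pos := ⟨L n, Submodule.subset_span ⟨n, hn, Or.inl rfl⟩⟩

/-- `W n` with `n > 0`, as an element of `W(2,2)₊`. -/
def posW (n : ℤ) (hn : 0 < n) : pos := ⟨W n, Submodule.subset_span ⟨n, hn, Or.inr rfl⟩⟩

/-- A Lie algebra homomorphism `φ : W(2,2)₊ → ℂ` is non-singular if `φ(L i) φ(W i) ≠ 0` for
`i = 1, 2`. -/
def IsNonsingular (φ : LieAlgebra.LieCharacter ℂ pos) : Prop :=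
  φ (posL 1 one_pos) * φ (posW 1 one_pos) ≠ 0 ∧ φ (posL 2 two_pos) * φ (posW 2 two_pos) ≠ 0

/-- A vector `v` of a `W(2,2)`-module is a Whittaker vector of type `φ` if `x v = φ(x) v` for all
`x ∈ W(2,2)₊`. -/
def IsWhittakerVector (φ : LieAlgebra.LieCharacter ℂ pos) {V : Type*} [AddCommGroup V]
    [Module ℂ V] [LieRingModule W22 V] [LieModule ℂ W22 V] (v : V) : Prop :=
  ∀ x : pos, ⁅(x : W22), v⁆ = φ x • v

end W22

section Induced

attribute [local instance 100] LieRing.ofAssociativeRing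

variable {R : Type*} [CommRing R] {g : Type*} [LieRing g] [LieAlgebra R g]

/-- The one-dimensional module of a character `χ` of a Lie algebra: the ground ring `R` with
`x a = χ(x) a`. -/
def CharModule (_χ : LieAlgebra.LieCharacter R g) : Type _ := R

namespace CharModule

variable (χ : LieAlgebra.LieCharacter R g)

instance : AddCommGroup (CharModule χ) := inferInstanceAs (AddCommGroup R)
instance : Module R (CharModule χ) := inferInstanceAs (Module R R)

/-- The element `1` of the one-dimensional module. -/
def one : CharModule χ := (1 : R)

instance : LieRingModule g (CharModule χ) where
  bracket x a := χ x • a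
  add_lie x y a := by simp only [map_add, add_smul]
  lie_add x a b := smul_add _ _ _
  leibniz_lie x y a := by
    change χ x • χ y • a = χ ⁅x, y⁆ • a + χ y • χ x • a
    rw [LieAlgebra.lieCharacter_apply_lie, zero_smul, zero_add, smul_comm]

instance : LieModule R g (CharModule χ) where
  smul_lie t x a := by
    change χ (t • x) • a = t • χ x • a
    rw [map_smul, smul_eq_mul, mul_smul]
  lie_smul t x a := smul_comm _ _ _

end CharModule

variable (h : LieSubalgebra R g) (V : Type*) [AddCommGroup V] [Module R V]
  [LieRingModule h V] [LieModule R h V]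

/-- The algebra homomorphism `U(h) → U(g)` induced by the inclusion of `h` in `g`. -/
def LieSubalgebra.envelopingMap :
    UniversalEnvelopingAlgebra R h →ₐ[R] UniversalEnvelopingAlgebra R g :=
  UniversalEnvelopingAlgebra.lift R ((UniversalEnvelopingAlgebra.ι R).comp h.incl)

/-- The algebra homomorphism `U(h) → End(V)` through which `U(h)` acts on an `h`-module `V`. -/
def LieSubalgebra.envelopingAction : UniversalEnvelopingAlgebra R h →ₐ[R] Module.End R V :=
  UniversalEnvelopingAlgebra.lift R (LieModule.toEnd R h V)

/-- The `U(g)`-submodule of `U(g) ⊗[R] V` generated by the elements `u a ⊗ v - u ⊗ a v`, for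
`u ∈ U(g)`, `a ∈ U(h)` and `v ∈ V`. -/
def LieSubalgebra.balancingSubmodule :
    Submodule (UniversalEnvelopingAlgebra R g) (UniversalEnvelopingAlgebra R g ⊗[R] V) :=
  Submodule.span (UniversalEnvelopingAlgebra R g)
    {t | ∃ (u : UniversalEnvelopingAlgebra R g) (a : UniversalEnvelopingAlgebra R h) (v : V),
      t = (u * h.envelopingMap a) ⊗ₜ[R] v - u ⊗ₜ[R] (h.envelopingAction V a v)}

/-- The induced module `U(g) ⊗_{U(h)} V`. Mathlib has tensor products over commutative rings only,
so it is the quotient of `U(g) ⊗[R] V` by the relations `u a ⊗ v = u ⊗ a v`. -/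
def LieSubalgebra.InducedModule : Type _ :=
  (UniversalEnvelopingAlgebra R g ⊗[R] V) ⧸ h.balancingSubmodule V

namespace LieSubalgebra.InducedModule

instance : AddCommGroup (h.InducedModule V) :=
  inferInstanceAs (AddCommGroup (_ ⧸ h.balancingSubmodule V))
instance : Module (UniversalEnvelopingAlgebra R g) (h.InducedModule V) :=
  inferInstanceAs (Module (UniversalEnvelopingAlgebra R g) (_ ⧸ h.balancingSubmodule V))
instance : Module R (h.InducedModule V) :=
  inferInstanceAs (Module R (_ ⧸ h.balancingSubmodule V))
instance : IsScalarTower R (UniversalEnvelopingAlgebra R g) (h.InducedModule V) :=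
  inferInstanceAs
    (IsScalarTower R (UniversalEnvelopingAlgebra R g) (_ ⧸ h.balancingSubmodule V))

variable {V}

/-- The class of `u ⊗ v` in `U(g) ⊗_{U(h)} V`. -/
def tmul (u : UniversalEnvelopingAlgebra R g) (v : V) : h.InducedModule V :=
  (h.balancingSubmodule V).mkQ (u ⊗ₜ[R] v)

variable (V)

/-- `g` acts on the induced module through `U(g)`. -/
instance : LieRingModule g (h.InducedModule V) where
  bracket x m := UniversalEnvelopingAlgebra.ι R x • m
  add_lie x y m := by simp only [map_add, add_smul]
  lie_add x m n := smul_add _ _ _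
  leibniz_lie x y m := by
    change (UniversalEnvelopingAlgebra.ι R x) • (UniversalEnvelopingAlgebra.ι R y) • m =
      (UniversalEnvelopingAlgebra.ι R ⁅x, y⁆) • m +
        (UniversalEnvelopingAlgebra.ι R y) • (UniversalEnvelopingAlgebra.ι R x) • m
    rw [LieHom.map_lie, LieRing.of_associative_ring_bracket, sub_smul, mul_smul, mul_smul,
      sub_add_cancel]

instance : LieModule R g (h.InducedModule V) where
  smul_lie t x m := by
    change (UniversalEnvelopingAlgebra.ι R (t • x)) • m = t • (UniversalEnvelopingAlgebra.ι R x) • m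
    rw [map_smul, smul_assoc]
  lie_smul t x m := by
    change (UniversalEnvelopingAlgebra.ι R x) • t • m = t • (UniversalEnvelopingAlgebra.ι R x) • m
    rw [← algebraMap_smul (UniversalEnvelopingAlgebra R g) t m, ← mul_smul,
      ← Algebra.commutes, mul_smul, algebraMap_smul]

end LieSubalgebra.InducedModule

end Induced

namespace W22

/-- The universal Whittaker module `M_φ = U(W(2,2)) ⊗_{U(W(2,2)₊)} ℂ_φ`. -/
abbrev UniversalWhittaker (φ : LieAlgebra.LieCharacter ℂ pos) : Type :=
  pos.InducedModule (CharModule φ)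

/-- The cyclic Whittaker vector `w = 1 ⊗ 1` of `M_φ`. -/
def cyclicVector (φ : LieAlgebra.LieCharacter ℂ pos) : UniversalWhittaker φ :=
  LieSubalgebra.InducedModule.tmul pos 1 (CharModule.one φ)

/-- The element `p(z)` of `U(W(2,2))`, for a polynomial `p` with complex coefficients. -/
def polyZ (p : Polynomial ℂ) : UniversalEnvelopingAlgebra ℂ W22 :=
  Polynomial.aeval (UniversalEnvelopingAlgebra.ι ℂ z) p

end W22

end

/-! A module generated by `w` is filtered by the number of factors `L (-i)`, `i ≥ 0`, applied to
`ℂ[z, W 0, W (-1), …] w`, and that subspace is filtered by the number of factors `W (-i)`. A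
positive element minus its scalar is a lowering operator: to leading order it is a first-order
derivation, whose coefficients are its commutators with the raising factors.

These coefficients, `[W (n+2), L (-i)]` and `[L (n+2), W (-i)]`, are multiples of `W (n+2-i)` plus
multiples of `z`. Since `φ` kills `W n` for `n ≥ 3` and `φ(W 2) ≠ 0`, they form a triangular matrix
modulo lower degree, with diagonal entries `-(2i+2) φ(W 2) ≠ 0`. If all lowering operators kill `v`,
triangularity makes the partial derivatives of `v` negligible, and Euler's identity `∑ x_i ∂_i v =
(deg v) v` pushes `v` into lower degree, hence eventually into the base.

The abstract form is `raisingFiltration.mem_base_of_forall_eq_zero`, resting on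
`raisingFiltration.exists_partials`. It is applied twice: the `W n` eliminate the `L (-i)`
(`mem_wSpan_of_mem_lFiltration`), then the `L n` eliminate the `W (-i)`
(`mem_zSpan_of_mem_wFiltration`), leaving `ℂ[z] w`. Partial derivatives are needed only up to lower
terms and only need to exist, so no PBW basis enters. -/

/-! ### Filtrations by raising operators and the Euler identity. -/

section RaisingFiltration

variable {K V : Type*} [Field K] [AddCommGroup V] [Module K V]

/-- The filtration obtained from the submodule `B` by applying the operators `a i` repeatedly:
`0`, `B`, `B + ∑ a i B`, and so on. -/
def raisingFiltration (B : Submodule K V) (a : ℕ → Module.End K V) : ℕ → Submodule K V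
  | 0 => ⊥
  | d + 1 => B ⊔ raisingFiltration B a d ⊔ ⨆ i, (raisingFiltration B a d).map (a i)

namespace raisingFiltration

variable {B : Submodule K V} {a : ℕ → Module.End K V}

theorem le_succ (d : ℕ) : raisingFiltration B a d ≤ raisingFiltration B a (d + 1) :=
  le_sup_right.trans le_sup_left

theorem mono : Monotone (raisingFiltration B a) := monotone_nat_of_le_succ le_succ

theorem base_le (d : ℕ) : B ≤ raisingFiltration B a (d + 1) :=
  le_sup_left.trans le_sup_left

theorem apply_mem {d : ℕ} {v : V} (hv : v ∈ raisingFiltration B a d) (i : ℕ) :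
    a i v ∈ raisingFiltration B a (d + 1) :=
  (le_iSup (fun i => (raisingFiltration B a d).map (a i)) i |>.trans le_sup_right)
    (Submodule.mem_map_of_mem hv)

theorem eq_zero {v : V} (hv : v ∈ raisingFiltration B a 0) : v = 0 := hv

theorem one_eq : raisingFiltration B a 1 = B := by
  simp [raisingFiltration]

theorem induction {p : ℕ → V → Prop} (hzero : ∀ d, p d 0)
    (hadd : ∀ d x y, p d x → p d y → p d (x + y)) (hbase : ∀ d, ∀ v ∈ B, p (d + 1) v)
    (hsucc : ∀ d, ∀ v ∈ raisingFiltration B a d, p d v → p (d + 1) v)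
    (happly : ∀ d i, ∀ v ∈ raisingFiltration B a d, p d v → p (d + 1) (a i v)) {d : ℕ} :
    ∀ v ∈ raisingFiltration B a d, p d v := by
  induction d with
  | zero =>
    intro v hv
    rw [eq_zero hv]
    exact hzero 0
  | succ d ih =>
    intro v hv
    obtain ⟨s, hs, y, hy, rfl⟩ := Submodule.mem_sup.mp hv
    obtain ⟨x, hx, x', hx', rfl⟩ := Submodule.mem_sup.mp hs
    refine hadd _ _ _ (hadd _ _ _ (hbase d x hx) (hsucc d x' hx' (ih x' hx'))) ?_
    refine Submodule.iSup_induction _ (motive := p (d + 1)) hy ?_ (hzero _) (hadd _)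
    rintro i _ ⟨u, hu, rfl⟩
    exact happly d i u hu (ih u hu)

variable {Q : ℕ → Submodule K V} {X : ℕ → Module.End K V} {A : ℕ → ℕ → Module.End K V}

/-- Each vector of the filtration has, up to lower terms, partial derivatives `f i` with respect to
the raising operators `a i`: they satisfy the Euler identity and compute the operators `X n`. -/
theorem exists_partials (hQ : Monotone Q)
    (hX : ∀ n i v, X n (a i v) = a i (X n v) + A n i v)
    (hXB : ∀ n, ∀ v ∈ B, X n v = 0)
    (haa : ∀ d i j, ∀ v ∈ raisingFiltration B a d,
      a i (a j v) - a j (a i v) ∈ raisingFiltration B a (d + 1))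
    (hQa : ∀ d i, ∀ v ∈ Q d, a i v ∈ Q (d + 1))
    (hAa : ∀ d n i j, ∀ v ∈ raisingFiltration B a d,
      a j (A n i v) - A n i (a j v) ∈ Q (d + 1)) {d : ℕ} :
    ∀ v ∈ raisingFiltration B a d, ∃ f : ℕ →₀ V,
      (∀ i, f i ∈ raisingFiltration B a (d - 1)) ∧
      (f.sum fun i u => a i u) - ((d - 1 : ℕ) : K) • v ∈ raisingFiltration B a (d - 1) ∧
      ∀ n, X n v - (f.sum fun i u => A n i u) ∈ Q (d - 1) := by
  have hsum : ∀ (T : ℕ → Module.End K V) (f g : ℕ →₀ V), ((f + g).sum fun i u => T i u) =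
      (f.sum fun i u => T i u) + g.sum fun i u => T i u := fun T f g =>
    Finsupp.sum_add_index' (fun i => map_zero (T i)) (fun i => map_add (T i))
  have hmem : ∀ (S : Submodule K V) (T : ℕ → Module.End K V) (f : ℕ →₀ V),
      (∀ i, T i (f i) ∈ S) → (f.sum fun i u => T i u) ∈ S := fun S T f h =>
    Submodule.sum_mem _ fun i _ => h i
  refine induction (p := fun d v => ∃ f : ℕ →₀ V,
      (∀ i, f i ∈ raisingFiltration B a (d - 1)) ∧
      (f.sum fun i u => a i u) - ((d - 1 : ℕ) : K) • v ∈ raisingFiltration B a (d - 1) ∧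
      ∀ n, X n v - (f.sum fun i u => A n i u) ∈ Q (d - 1)) ?_ ?_ ?_ ?_ ?_
  · intro d
    exact ⟨0, by simp⟩
  · rintro d x y ⟨f, hf, hfa, hfX⟩ ⟨g, hg, hga, hgX⟩
    refine ⟨f + g, fun i => Submodule.add_mem _ (hf i) (hg i), ?_, fun n => ?_⟩
    · rw [hsum, smul_add, add_sub_add_comm]
      exact Submodule.add_mem _ hfa hga
    · rw [hsum, map_add, add_sub_add_comm]
      exact Submodule.add_mem _ (hfX n) (hgX n)
  · intro d v hv
    -- A base vector has zero partials. The Euler term `d • v` vanishes for `d = 0`; otherwise `v`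
    -- already lies in stage `d`.
    refine ⟨0, by simp, ?_, fun n => by simp [hXB n v hv]⟩
    rw [Finsupp.sum_zero_index, zero_sub, Nat.add_sub_cancel]
    rcases d with _ | d
    · simp
    · exact Submodule.neg_mem _ (Submodule.smul_mem _ _ (base_le d hv))
  · rintro d v hv ⟨f, hf, hfa, hfX⟩
    have hle : d - 1 ≤ d := Nat.sub_le d 1
    -- The same partials serve: one stage up, both terms of the Euler identity count as lower terms.
    refine ⟨f, fun i => mono hle (hf i), ?_, fun n => hQ hle (hfX n)⟩
    have h1 := Submodule.add_mem _ (mono hle hfa)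
      (Submodule.smul_mem _ ((d - 1 : ℕ) : K) hv)
    rw [sub_add_cancel] at h1
    exact Submodule.sub_mem _ h1 (Submodule.smul_mem _ _ hv)
  · rintro d j u hu ⟨f, hf, hfa, hfX⟩
    rcases d with _ | d
    · rw [eq_zero hu]
      exact ⟨0, by simp⟩
    simp only [Nat.add_sub_cancel] at hf hfa hfX ⊢
    have hg : ∀ T : ℕ → Module.End K V,
        ((Finsupp.single j u + f.mapRange (a j) (map_zero _)).sum fun i u => T i u) =
          T j u + f.sum fun i u => T i (a j u) := fun T => by
      rw [hsum, Finsupp.sum_single_index (h := fun i u => T i u) (map_zero (T j)),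
        Finsupp.sum_mapRange_index fun i => map_zero (T i)]
    -- Leibniz rule: `∂_i (a_j u) = δ_ij u + a_j (∂_i u)`. The commutators of `a j` with `a i` and
    -- `A n i` go into the error terms.
    refine ⟨Finsupp.single j u + f.mapRange (a j) (map_zero _), fun i => ?_, ?_, fun n => ?_⟩
    · rw [Finsupp.add_apply, Finsupp.mapRange_apply]
      refine Submodule.add_mem _ ?_ (apply_mem (hf i) j)
      rw [Finsupp.single_apply]
      split_ifs
      exacts [hu, Submodule.zero_mem _]
    · have h1 := Submodule.add_mem _ (apply_mem hfa j)
        (hmem _ (fun i => a i * a j - a j * a i) f fun i => haa d i j _ (hf i))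
      convert h1 using 1
      rw [hg a]
      simp only [Finsupp.sum, map_sub, map_sum, map_smul, LinearMap.sub_apply,
        Module.End.mul_apply, Finset.sum_sub_distrib]
      push_cast
      module
    · have h1 := Submodule.add_mem _ (hQa _ j _ (hfX n))
        (hmem _ (fun i => a j * A n i - A n i * a j) f fun i => hAa d n i j _ (hf i))
      convert h1 using 1
      rw [hg (A n), hX]
      simp only [Finsupp.sum, map_sub, map_sum, LinearMap.sub_apply,
        Module.End.mul_apply, Finset.sum_sub_distrib]
      abel

/-- If the commutators `A n i` of the lowering operators `X n` with the raising operators `a i` are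
triangular modulo lower terms, with nonzero scalars `c i` on the diagonal, then the vectors of the
filtration that are annihilated by all `X n` lie in `B`. -/
theorem mem_base_of_forall_eq_zero [CharZero K] (hQ : Monotone Q)
    (hX : ∀ n i v, X n (a i v) = a i (X n v) + A n i v)
    (hXB : ∀ n, ∀ v ∈ B, X n v = 0)
    (haa : ∀ d i j, ∀ v ∈ raisingFiltration B a d,
      a i (a j v) - a j (a i v) ∈ raisingFiltration B a (d + 1))
    (hQG : ∀ d, Q d ≤ raisingFiltration B a (d - 1))
    (hQa : ∀ d i, ∀ v ∈ Q d, a i v ∈ Q (d + 1))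
    (hAa : ∀ d n i j, ∀ v ∈ raisingFiltration B a d,
      a j (A n i v) - A n i (a j v) ∈ Q (d + 1))
    (hAQ : ∀ d n i, ∀ v ∈ Q d, A n i v ∈ Q d)
    (hlow : ∀ d n i, i < n → ∀ v ∈ raisingFiltration B a d, A n i v ∈ Q d)
    {c : ℕ → K} (hc : ∀ i, c i ≠ 0)
    (hdiag : ∀ d i, ∀ v ∈ raisingFiltration B a d, A i i v - c i • v ∈ Q d) {d : ℕ} :
    ∀ v ∈ raisingFiltration B a d, (∀ n, X n v = 0) → v ∈ B := by
  induction d with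
  | zero =>
    intro v hv _
    rw [eq_zero hv]
    exact Submodule.zero_mem _
  | succ d ih =>
    intro v hv hXv
    obtain ⟨f, hf, hfa, hfX⟩ := exists_partials hQ hX hXB haa hQa hAa v hv
    simp only [Nat.add_sub_cancel, hXv, zero_sub, neg_mem_iff] at hf hfa hfX
    rcases d with _ | d
    -- Stage 1 is the base itself; beyond it the Euler factor `d + 1` is nonzero.
    · rwa [zero_add, one_eq] at hv
    -- Back substitution from above the support of `f`. In row `i`, columns `j < i` are negligible
    -- by `hlow`, columns `j > i` because `f j` is already in `Q`, so `c i • f i` is in `Q`.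
    have hfQ : ∀ k i, f.support.sup id + 1 ≤ i + k → f i ∈ Q (d + 1) := by
      intro k
      induction k with
      | zero =>
        intro i hi
        have : f i = 0 := by
          by_contra h
          have := Finset.le_sup (f := id) (Finsupp.mem_support_iff.mpr h)
          simp only [id] at this
          omega
        rw [this]
        exact Submodule.zero_mem _
      | succ k ihk =>
        intro i hi
        by_cases h0 : f i = 0
        · rw [h0]
          exact Submodule.zero_mem _
        have hrest : ∑ j ∈ f.support.erase i, A i j (f j) ∈ Q (d + 1) := by
          refine Submodule.sum_mem _ fun j hj => ?_
          rcases lt_or_gt_of_ne (Finset.ne_of_mem_erase hj) with h | h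
          · exact hlow _ _ _ h _ (hf j)
          · exact hAQ _ _ _ _ (ihk j (by omega))
        have h1 := hfX i
        rw [Finsupp.sum, ← Finset.add_sum_erase _ _ (Finsupp.mem_support_iff.mpr h0)] at h1
        have h2 := Submodule.sub_mem _ ((Submodule.add_mem_iff_left _ hrest).mp h1)
          (hdiag _ i _ (hf i))
        rw [sub_sub_cancel] at h2
        exact (Submodule.smul_mem_iff _ (hc i)).mp h2
    have hfa' : (f.sum fun i u => a i u) ∈ raisingFiltration B a (d + 1) :=
      Submodule.sum_mem _ fun i _ => apply_mem (hQG _ (hfQ _ i (Nat.le_add_left _ _))) i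
    have h1 := (Submodule.sub_mem_iff_right _ hfa').mp hfa
    exact ih v ((Submodule.smul_mem_iff _ (Nat.cast_ne_zero.mpr d.succ_ne_zero)).mp h1) hXv

end raisingFiltration

end RaisingFiltration

/-! ### Commutation relations in `W(2,2)`-modules and the subspace `ℂ[z] w`. -/

namespace W22

variable {V : Type*} [AddCommGroup V] [LieRingModule W22 V]

theorem lie_z_left (x : W22) : ⁅z, x⁆ = 0 := bracketHom_z_left x

theorem lie_lie_z (x : W22) (v : V) : ⁅x, ⁅z, v⁆⁆ = ⁅z, ⁅x, v⁆⁆ := by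
  rw [leibniz_lie z x v, lie_z_left, zero_lie, zero_add]

theorem lie_W_W_comm (n m : ℤ) (v : V) : ⁅W n, ⁅W m, v⁆⁆ = ⁅W m, ⁅W n, v⁆⁆ := by
  rw [leibniz_lie, lie_W_W, zero_lie, zero_add]

variable [Module ℂ V] [LieModule ℂ W22 V]

theorem lie_L_lie_W (n m : ℤ) (v : V) : ⁅L n, ⁅W m, v⁆⁆ =
    ⁅W m, ⁅L n, v⁆⁆ + (((m : ℂ) - n) • ⁅W (m + n), v⁆ + cocycle n m • ⁅z, v⁆) := by
  rw [leibniz_lie, lie_L_W, add_lie, smul_lie, smul_lie, add_comm]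

theorem lie_W_lie_L (n m : ℤ) (v : V) : ⁅W n, ⁅L m, v⁆⁆ =
    ⁅L m, ⁅W n, v⁆⁆ - (((n : ℂ) - m) • ⁅W (n + m), v⁆ + cocycle m n • ⁅z, v⁆) := by
  rw [leibniz_lie, lie_W_L, neg_lie, add_lie, smul_lie, smul_lie, add_comm, ← sub_eq_add_neg]

theorem lie_L_lie_L (n m : ℤ) (v : V) : ⁅L n, ⁅L m, v⁆⁆ =
    ⁅L m, ⁅L n, v⁆⁆ + (((m : ℂ) - n) • ⁅L (m + n), v⁆ + cocycle n m • ⁅z, v⁆) := by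
  rw [leibniz_lie, lie_L_L, add_lie, smul_lie, smul_lie, add_comm]

/-- The subspace `ℂ[z] w` of a `W(2,2)`-module. -/
noncomputable def zSpan (w : V) : Submodule ℂ V :=
  LinearMap.range ((LinearMap.applyₗ w).comp
    (Polynomial.aeval (LieModule.toEnd ℂ W22 V z)).toLinearMap)

theorem mem_zSpan {w v : V} :
    v ∈ zSpan w ↔ ∃ p : Polynomial ℂ, Polynomial.aeval (LieModule.toEnd ℂ W22 V z) p w = v :=
  Iff.rfl

theorem self_mem_zSpan (w : V) : w ∈ zSpan w := mem_zSpan.mpr ⟨1, by simp⟩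

theorem lie_z_mem_zSpan {w v : V} (hv : v ∈ zSpan w) : ⁅z, v⁆ ∈ zSpan w := by
  obtain ⟨p, rfl⟩ := mem_zSpan.mp hv
  exact mem_zSpan.mpr ⟨Polynomial.X * p, by simp⟩

/-- As `z` is central, `x` commutes with every `p(z)`. -/
theorem lie_eq_smul_of_mem_zSpan {w v : V} {x : W22} {t : ℂ} (hx : ⁅x, w⁆ = t • w)
    (hv : v ∈ zSpan w) : ⁅x, v⁆ = t • v := by
  obtain ⟨p, rfl⟩ := mem_zSpan.mp hv
  have h : Commute (LieModule.toEnd ℂ W22 V x) (LieModule.toEnd ℂ W22 V z) :=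
    LinearMap.ext fun v => lie_lie_z x v
  have h' : Commute (LieModule.toEnd ℂ W22 V x)
      (Polynomial.aeval (LieModule.toEnd ℂ W22 V z) p) := by
    rw [Polynomial.aeval_eq_sum_range]
    exact Commute.sum_right _ _ _ fun i _ => (h.pow_right i).smul_right _
  have h2 := congrArg (fun f => f w) h'.eq
  simp only [Module.End.mul_apply, LieModule.toEnd_apply_apply] at h2
  rw [h2, hx, map_smul]

/-! ### Degree in the `W (-i)`, lowered by the positive `L n`. -/

/-- The elements of `ℂ[z, W 0, W (-1), …] w` of degree less than `d` in the `W (-i)`. -/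
noncomputable def wFiltration (w : V) : ℕ → Submodule ℂ V :=
  raisingFiltration (zSpan w) fun i => LieModule.toEnd ℂ W22 V (W (-i))

theorem lie_z_mem_wFiltration (w : V) {d : ℕ} :
    ∀ v ∈ wFiltration w d, ⁅z, v⁆ ∈ wFiltration w d := by
  refine raisingFiltration.induction (p := fun d v => ⁅z, v⁆ ∈ wFiltration w d) ?_ ?_ ?_ ?_ ?_
  · intro d
    simp
  · intro d x y hx hy
    rw [lie_add]
    exact Submodule.add_mem _ hx hy
  · exact fun d v hv => raisingFiltration.base_le d (lie_z_mem_zSpan hv)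
  · exact fun d v _ hv => raisingFiltration.le_succ d hv
  · intro d i v _ hv
    rw [LieModule.toEnd_apply_apply, ← lie_lie_z]
    exact raisingFiltration.apply_mem hv i

variable {w : V} {μ ν : ℤ → ℂ}

/-- `W n` commutes with `z` and with all the `W (-i)`, so it passes through to `w`. -/
theorem lie_W_eq_smul_of_mem_wFiltration (hW : ∀ n, 0 < n → ⁅W n, w⁆ = μ n • w) {n : ℤ}
    (hn : 0 < n) {d : ℕ} : ∀ v ∈ wFiltration w d, ⁅W n, v⁆ = μ n • v := by
  refine raisingFiltration.induction (p := fun _ v => ⁅W n, v⁆ = μ n • v) ?_ ?_ ?_ ?_ ?_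
  · simp
  · intro d x y hx hy
    rw [lie_add, hx, hy, smul_add]
  · exact fun d v hv => lie_eq_smul_of_mem_zSpan (hW n hn) hv
  · exact fun d v _ hv => hv
  · intro d i v _ hv
    rw [LieModule.toEnd_apply_apply, lie_W_W_comm, hv, lie_smul]

theorem lie_W_mem_wFiltration (hW : ∀ n, 0 < n → ⁅W n, w⁆ = μ n • w) (n : ℤ) {d : ℕ} {v : V}
    (hv : v ∈ wFiltration w d) : ⁅W n, v⁆ ∈ wFiltration w (d + 1) := by
  rcases lt_or_ge 0 n with hn | hn
  · rw [lie_W_eq_smul_of_mem_wFiltration hW hn v hv]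
    exact Submodule.smul_mem _ _ (raisingFiltration.le_succ d hv)
  · obtain ⟨i, rfl⟩ : ∃ i : ℕ, n = -i := ⟨n.natAbs, by omega⟩
    exact raisingFiltration.apply_mem hv i

/-- Moving `L n` past `W (-i)` trades that factor for `W (n-i)` or `z`, so the degree does not rise.
-/
theorem lie_L_mem_wFiltration (hW : ∀ n, 0 < n → ⁅W n, w⁆ = μ n • w)
    (hL : ∀ n, 0 < n → ⁅L n, w⁆ = ν n • w) {n : ℤ} (hn : 0 < n) {d : ℕ} :
    ∀ v ∈ wFiltration w d, ⁅L n, v⁆ ∈ wFiltration w d := by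
  refine raisingFiltration.induction (p := fun d v => ⁅L n, v⁆ ∈ wFiltration w d) ?_ ?_ ?_ ?_ ?_
  · simp
  · intro d x y hx hy
    rw [lie_add]
    exact Submodule.add_mem _ hx hy
  · intro d v hv
    rw [lie_eq_smul_of_mem_zSpan (hL n hn) hv]
    exact Submodule.smul_mem _ _ (raisingFiltration.base_le d hv)
  · exact fun d v _ hv => raisingFiltration.le_succ d hv
  · intro d i v hv hLv
    rw [LieModule.toEnd_apply_apply, lie_L_lie_W]
    refine Submodule.add_mem _ (raisingFiltration.apply_mem hLv i) (Submodule.add_mem _ ?_ ?_)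
    · exact Submodule.smul_mem _ _ (lie_W_mem_wFiltration hW _ hv)
    · exact Submodule.smul_mem _ _
        (raisingFiltration.le_succ d (lie_z_mem_wFiltration w v hv))

theorem mem_zSpan_of_mem_wFiltration (hW : ∀ n, 0 < n → ⁅W n, w⁆ = μ n • w)
    (hL : ∀ n, 0 < n → ⁅L n, w⁆ = ν n • w) (hμ : ∀ n, 3 ≤ n → μ n = 0) (hμ2 : μ 2 ≠ 0)
    {d : ℕ} {v : V} (hv : v ∈ wFiltration w d) (hLv : ∀ n, 0 < n → ⁅L n, v⁆ = ν n • v) :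
    v ∈ zSpan w := by
  have hshift : ∀ i : ℕ, (0 : ℤ) < i + 2 := fun i => by omega
  -- The shift by 2 puts `W 2` on the diagonal. Positive `W n` act by exact scalars here, so no
  -- error term is needed and `Q` is zero.
  refine raisingFiltration.mem_base_of_forall_eq_zero (Q := fun _ => ⊥)
    (X := fun n => LieModule.toEnd ℂ W22 V (L (n + 2)) - ν (n + 2) • 1)
    (A := fun n i => LieModule.toEnd ℂ W22 V ⁅L (n + 2), W (-i)⁆)
    (c := fun i => (-(i : ℂ) - (i + 2)) * μ 2) ?_ ?_ ?_ ?_ ?_ ?_ ?_ ?_ ?_ ?_ ?_ v hv ?_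
  · exact monotone_const
  · intro n i v
    simp
  · intro n v hv
    simp [lie_eq_smul_of_mem_zSpan (hL _ (hshift n)) hv]
  · intro d i j v _
    simp [lie_W_W_comm (-i) (-j)]
  · simp
  · simp
  · intro d n i j v _
    simp [lie_L_W, lie_W_W_comm (-j), lie_lie_z]
  · simp
  · intro d n i h v hv
    have h0 : cocycle (n + 2) (-i) = 0 := if_neg (by omega)
    simp [lie_L_W, h0, hμ (-i + (n + 2)) (by omega),
      lie_W_eq_smul_of_mem_wFiltration hW (n := -i + (n + 2)) (by omega) v hv]
  · intro i
    refine mul_ne_zero ?_ hμ2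
    have : (-(i : ℂ) - (i + 2)) = -((2 * i + 2 : ℕ) : ℂ) := by push_cast; ring
    rw [this]
    exact neg_ne_zero.mpr (Nat.cast_ne_zero.mpr (by omega))
  · intro d i v hv
    have h0 : cocycle (i + 2) (-i) = 0 := if_neg (by omega)
    simp [lie_L_W, h0, mul_smul, lie_W_eq_smul_of_mem_wFiltration hW two_pos v hv]
  · intro n
    simp [hLv _ (hshift n)]

/-! ### Degree in the `L (-i)`, lowered by the positive `W n`. -/

/-- The subspace `ℂ[z, W 0, W (-1), …] w` of a `W(2,2)`-module. -/
noncomputable def wSpan (w : V) : Submodule ℂ V := ⨆ d, wFiltration w d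

theorem mem_wSpan {v : V} : v ∈ wSpan w ↔ ∃ d, v ∈ wFiltration w d :=
  Submodule.mem_iSup_of_directed _ raisingFiltration.mono.directed_le

/-- The elements of the module of degree less than `d` in the `L (-i)`. -/
noncomputable def lFiltration (w : V) : ℕ → Submodule ℂ V :=
  raisingFiltration (wSpan w) fun i => LieModule.toEnd ℂ W22 V (L (-i))

theorem lie_z_mem_lFiltration (w : V) {d : ℕ} :
    ∀ v ∈ lFiltration w d, ⁅z, v⁆ ∈ lFiltration w d := by
  refine raisingFiltration.induction (p := fun d v => ⁅z, v⁆ ∈ lFiltration w d) ?_ ?_ ?_ ?_ ?_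
  · intro d
    simp
  · intro d x y hx hy
    rw [lie_add]
    exact Submodule.add_mem _ hx hy
  · intro d v hv
    obtain ⟨k, hk⟩ := mem_wSpan.mp hv
    exact raisingFiltration.base_le d (mem_wSpan.mpr ⟨k, lie_z_mem_wFiltration w v hk⟩)
  · exact fun d v _ hv => raisingFiltration.le_succ d hv
  · intro d i v _ hv
    rw [LieModule.toEnd_apply_apply, ← lie_lie_z]
    exact raisingFiltration.apply_mem hv i

/-- Commuting past `L (-i)` yields only another `W` and `z`. The index changes, so the induction
runs over all `n` at once. -/
theorem lie_W_mem_lFiltration (hW : ∀ n, 0 < n → ⁅W n, w⁆ = μ n • w) {d : ℕ} :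
    ∀ v ∈ lFiltration w d, ∀ n, ⁅W n, v⁆ ∈ lFiltration w d := by
  refine raisingFiltration.induction (p := fun d v => ∀ n, ⁅W n, v⁆ ∈ lFiltration w d)
    ?_ ?_ ?_ ?_ ?_
  · simp
  · intro d x y hx hy n
    rw [lie_add]
    exact Submodule.add_mem _ (hx n) (hy n)
  · intro d v hv n
    obtain ⟨k, hk⟩ := mem_wSpan.mp hv
    exact raisingFiltration.base_le d (mem_wSpan.mpr ⟨k + 1, lie_W_mem_wFiltration hW n hk⟩)
  · exact fun d v _ hv n => raisingFiltration.le_succ d (hv n)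
  · intro d i v hv hWv n
    rw [LieModule.toEnd_apply_apply, lie_W_lie_L]
    refine Submodule.sub_mem _ (raisingFiltration.apply_mem (hWv n) i)
      (raisingFiltration.le_succ d (Submodule.add_mem _ ?_ ?_))
    · exact Submodule.smul_mem _ _ (hWv _)
    · exact Submodule.smul_mem _ _ (lie_z_mem_lFiltration w v hv)

/-- Each commutator with some `L (-i)` uses up that factor, so the scalar action fails only in lower
degree. -/
theorem lie_W_sub_smul_mem_lFiltration (hW : ∀ n, 0 < n → ⁅W n, w⁆ = μ n • w) {n : ℤ}
    (hn : 0 < n) {d : ℕ} :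
    ∀ v ∈ lFiltration w d, ⁅W n, v⁆ - μ n • v ∈ lFiltration w (d - 1) := by
  refine raisingFiltration.induction
    (p := fun d v => ⁅W n, v⁆ - μ n • v ∈ lFiltration w (d - 1)) ?_ ?_ ?_ ?_ ?_
  · simp
  · intro d x y hx hy
    rw [lie_add, smul_add, add_sub_add_comm]
    exact Submodule.add_mem _ hx hy
  · intro d v hv
    obtain ⟨k, hk⟩ := mem_wSpan.mp hv
    simp [lie_W_eq_smul_of_mem_wFiltration hW hn v hk]
  · exact fun d v _ hv => raisingFiltration.mono (Nat.sub_le d 1) hv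
  · intro d i v hv hWv
    rcases d with _ | d
    · simp [raisingFiltration.eq_zero hv]
    rw [LieModule.toEnd_apply_apply, lie_W_lie_L, sub_right_comm, ← lie_smul, ← lie_sub]
    refine Submodule.sub_mem _ (raisingFiltration.apply_mem hWv i) (Submodule.add_mem _ ?_ ?_)
    · exact Submodule.smul_mem _ _ (lie_W_mem_lFiltration hW v hv _)
    · exact Submodule.smul_mem _ _ (lie_z_mem_lFiltration w v hv)

theorem lie_L_mem_lFiltration (hW : ∀ n, 0 < n → ⁅W n, w⁆ = μ n • w)
    (hL : ∀ n, 0 < n → ⁅L n, w⁆ = ν n • w) {d : ℕ} :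
    ∀ v ∈ lFiltration w d, ∀ n, ⁅L n, v⁆ ∈ lFiltration w (d + 1) ∧
      (0 < n → ⁅L n, v⁆ ∈ lFiltration w d) := by
  -- The two bounds are intertwined: `[L n, L (-i)]` with `n > 0` may involve a nonpositive `L
  -- (n-i)`, whose extra degree is paid for by the factor `L (-i)` just removed.
  have key : ∀ d, ∀ v ∈ lFiltration w d, (∀ n, 0 < n → ⁅L n, v⁆ ∈ lFiltration w d) → ∀ n,
      ⁅L n, v⁆ ∈ lFiltration w (d + 1) := by
    intro d v hv hpos n
    rcases lt_or_ge 0 n with hn | hn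
    · exact raisingFiltration.le_succ d (hpos n hn)
    · obtain ⟨i, rfl⟩ : ∃ i : ℕ, n = -i := ⟨n.natAbs, by omega⟩
      exact raisingFiltration.apply_mem hv i
  have hpos : ∀ d, ∀ v ∈ lFiltration w d, ∀ n, 0 < n → ⁅L n, v⁆ ∈ lFiltration w d := by
    intro d
    refine raisingFiltration.induction
      (p := fun d v => ∀ n, 0 < n → ⁅L n, v⁆ ∈ lFiltration w d) ?_ ?_ ?_ ?_ ?_
    · simp
    · intro d x y hx hy n hn
      rw [lie_add]
      exact Submodule.add_mem _ (hx n hn) (hy n hn)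
    · intro d v hv n hn
      obtain ⟨k, hk⟩ := mem_wSpan.mp hv
      exact raisingFiltration.base_le d
        (mem_wSpan.mpr ⟨k, lie_L_mem_wFiltration hW hL hn v hk⟩)
    · exact fun d v _ hv n hn => raisingFiltration.le_succ d (hv n hn)
    · intro d i v hv hLv n hn
      rw [LieModule.toEnd_apply_apply, lie_L_lie_L]
      refine Submodule.add_mem _ (raisingFiltration.apply_mem (hLv n hn) i)
        (Submodule.add_mem _ ?_ ?_)
      · exact Submodule.smul_mem _ _ (key d v hv hLv _)
      · exact Submodule.smul_mem _ _
          (raisingFiltration.le_succ d (lie_z_mem_lFiltration w v hv))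
  exact fun v hv n => ⟨key d v hv (hpos d v hv) n, hpos d v hv n⟩

theorem mem_wSpan_of_mem_lFiltration (hW : ∀ n, 0 < n → ⁅W n, w⁆ = μ n • w)
    (hL : ∀ n, 0 < n → ⁅L n, w⁆ = ν n • w) (hμ : ∀ n, 3 ≤ n → μ n = 0) (hμ2 : μ 2 ≠ 0)
    {d : ℕ} {v : V} (hv : v ∈ lFiltration w d) (hWv : ∀ n, 0 < n → ⁅W n, v⁆ = μ n • v) :
    v ∈ wSpan w := by
  have hshift : ∀ i : ℕ, (0 : ℤ) < i + 2 := fun i => by omega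
  have hA : ∀ (d n i : ℕ), ∀ v ∈ lFiltration w d,
      ⁅⁅W (n + 2), L (-i)⁆, v⁆ ∈ lFiltration w d := by
    intro d n i v hv
    rw [lie_W_L, neg_lie, add_lie, smul_lie, smul_lie]
    exact Submodule.neg_mem _ (Submodule.add_mem _
      (Submodule.smul_mem _ _ (lie_W_mem_lFiltration hW v hv _))
      (Submodule.smul_mem _ _ (lie_z_mem_lFiltration w v hv)))
  -- Scalars are now correct only modulo lower degree, hence `Q` is the filtration shifted by one;
  -- truncated subtraction is harmless since stage 0 is zero.
  refine raisingFiltration.mem_base_of_forall_eq_zero (Q := fun d => lFiltration w (d - 1))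
    (X := fun n => LieModule.toEnd ℂ W22 V (W (n + 2)) - μ (n + 2) • 1)
    (A := fun n i => LieModule.toEnd ℂ W22 V ⁅W (n + 2), L (-i)⁆)
    (c := fun i => -(((i : ℂ) + 2 + i) * μ 2)) ?_ ?_ ?_ ?_ ?_ ?_ ?_ ?_ ?_ ?_ ?_ v hv ?_
  · exact fun d e h => raisingFiltration.mono (Nat.sub_le_sub_right h 1)
  · intro n i v
    simp
  · intro n v hv
    obtain ⟨k, hk⟩ := mem_wSpan.mp hv
    simp [lie_W_eq_smul_of_mem_wFiltration hW (hshift n) v hk]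
  · intro d i j v hv
    simp only [LieModule.toEnd_apply_apply]
    rw [lie_L_lie_L, add_sub_cancel_left]
    exact Submodule.add_mem _
      (Submodule.smul_mem _ _ (lie_L_mem_lFiltration hW hL v hv _).1)
      (Submodule.smul_mem _ _ (raisingFiltration.le_succ d (lie_z_mem_lFiltration w v hv)))
  · exact fun d => le_rfl
  · intro d i v hv
    rcases d with _ | d
    · simp [raisingFiltration.eq_zero hv]
    · exact raisingFiltration.apply_mem hv i
  · intro d n i j v hv
    simp only [LieModule.toEnd_apply_apply, Nat.add_sub_cancel]
    have hz : ⁅L (-j), z⁆ = 0 := bracketHom_z_right _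
    rw [← lie_lie, lie_W_L, lie_neg, lie_add, lie_smul, lie_smul, lie_L_W, hz, smul_zero, add_zero,
      neg_lie, smul_lie, add_lie, smul_lie, smul_lie]
    exact Submodule.neg_mem _ (Submodule.smul_mem _ _ (Submodule.add_mem _
      (Submodule.smul_mem _ _ (lie_W_mem_lFiltration hW v hv _))
      (Submodule.smul_mem _ _ (lie_z_mem_lFiltration w v hv))))
  · exact fun d n i v hv => hA _ n i v hv
  · intro d n i h v hv
    have h0 : cocycle (-i) (n + 2) = 0 := if_neg (by omega)
    have h1 := lie_W_sub_smul_mem_lFiltration hW (n := n + 2 + -i) (by omega) v hv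
    rw [hμ _ (by omega), zero_smul, sub_zero] at h1
    simp only [LieModule.toEnd_apply_apply, lie_W_L, h0, zero_smul, add_zero, neg_lie, smul_lie]
    exact Submodule.neg_mem _ (Submodule.smul_mem _ _ h1)
  · intro i
    refine neg_ne_zero.mpr (mul_ne_zero ?_ hμ2)
    have : ((i : ℂ) + 2 + i) = ((2 * i + 2 : ℕ) : ℂ) := by push_cast; ring
    rw [this]
    exact Nat.cast_ne_zero.mpr (by omega)
  · intro d i v hv
    have h0 : cocycle (-i) (i + 2) = 0 := if_neg (by omega)
    have h1 := lie_W_sub_smul_mem_lFiltration hW two_pos v hv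
    have h2 : (i : ℤ) + 2 + -i = 2 := by ring
    simp only [LieModule.toEnd_apply_apply, lie_W_L, h0, zero_smul, add_zero, neg_lie, smul_lie, h2]
    convert Submodule.smul_mem _ (-((i : ℂ) + 2 + i)) h1 using 1
    push_cast
    module
  · intro n
    simp [hWv _ (hshift n)]

/-- In a `W(2,2)`-module generated by a Whittaker vector `w` whose character does not vanish on
`W 2`, every Whittaker vector of the same type lies in `ℂ[z] w`. -/
theorem mem_zSpan_of_cyclic (hW : ∀ n, 0 < n → ⁅W n, w⁆ = μ n • w)
    (hL : ∀ n, 0 < n → ⁅L n, w⁆ = ν n • w) (hμ : ∀ n, 3 ≤ n → μ n = 0) (hμ2 : μ 2 ≠ 0)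
    (hcyc : ∀ N : Submodule ℂ V, w ∈ N → (∀ x : W22, ∀ v ∈ N, ⁅x, v⁆ ∈ N) → N = ⊤)
    {v : V} (hWv : ∀ n, 0 < n → ⁅W n, v⁆ = μ n • v) (hLv : ∀ n, 0 < n → ⁅L n, v⁆ = ν n • v) :
    v ∈ zSpan w := by
  have hmem : ∀ {v}, v ∈ ⨆ d, lFiltration w d ↔ ∃ d, v ∈ lFiltration w d :=
    Submodule.mem_iSup_of_directed _ raisingFiltration.mono.directed_le
  have htop : ⨆ d, lFiltration w d = ⊤ := by
    refine hcyc _ ?_ fun x v hv => ?_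
    · exact hmem.mpr ⟨1, raisingFiltration.base_le 0
        (mem_wSpan.mpr ⟨1, raisingFiltration.base_le 0 (self_mem_zSpan w)⟩)⟩
    · obtain ⟨d, hd⟩ := hmem.mp hv
      refine basis_induction (p := fun x => ⁅x, v⁆ ∈ ⨆ d, lFiltration w d) ?_ ?_ ?_ ?_ x
      · rintro (n | n | _)
        · exact hmem.mpr ⟨d + 1, (lie_L_mem_lFiltration hW hL v hd n).1⟩
        · exact hmem.mpr ⟨d, lie_W_mem_lFiltration hW v hd n⟩
        · exact hmem.mpr ⟨d, lie_z_mem_lFiltration w v hd⟩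
      · simp
      · intro x y hx hy
        rw [add_lie]
        exact Submodule.add_mem _ hx hy
      · intro t x hx
        rw [smul_lie]
        exact Submodule.smul_mem _ _ hx
  obtain ⟨d, hd⟩ := hmem.mp (htop ▸ Submodule.mem_top : v ∈ ⨆ d, lFiltration w d)
  obtain ⟨k, hk⟩ := mem_wSpan.mp (mem_wSpan_of_mem_lFiltration hW hL hμ hμ2 hd hWv)
  exact mem_zSpan_of_mem_wFiltration hW hL hμ hμ2 hk hLv

end W22

/-! ### The induced module is cyclic, generated by a Whittaker vector. -/

section Induced

variable {R : Type*} [CommRing R] {g : Type*} [LieRing g] [LieAlgebra R g]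

/-- A subspace of a module over the enveloping algebra that is stable under the Lie algebra is
stable under the enveloping algebra. -/
theorem UniversalEnvelopingAlgebra.smul_mem_of_forall_ι_smul_mem {M : Type*} [AddCommGroup M]
    [Module R M] [Module (UniversalEnvelopingAlgebra R g) M]
    [IsScalarTower R (UniversalEnvelopingAlgebra R g) M] {N : Submodule R M}
    (hN : ∀ x : g, ∀ v ∈ N, UniversalEnvelopingAlgebra.ι R x • v ∈ N)
    (u : UniversalEnvelopingAlgebra R g) : ∀ v ∈ N, u • v ∈ N := by
  obtain ⟨t, rfl⟩ : ∃ t, UniversalEnvelopingAlgebra.mkAlgHom R g t = u :=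
    Quotient.exists_rep u
  induction t using TensorAlgebra.induction with
  | algebraMap r =>
    intro v hv
    rw [AlgHom.commutes, algebraMap_smul]
    exact N.smul_mem r hv
  | ι x => exact fun v hv => hN x v hv
  | mul a b ha hb =>
    intro v hv
    rw [map_mul, mul_smul]
    exact ha _ (hb v hv)
  | add a b ha hb =>
    intro v hv
    rw [map_add, add_smul]
    exact N.add_mem (ha v hv) (hb v hv)

namespace LieSubalgebra.InducedModule

variable (h : LieSubalgebra R g)

theorem smul_tmul {V : Type*} [AddCommGroup V] [Module R V] [LieRingModule h V] [LieModule R h V]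
    (u u' : UniversalEnvelopingAlgebra R g) (v : V) :
    u • tmul h u' v = tmul h (u * u') v := rfl

theorem lie_tmul_one (χ : LieAlgebra.LieCharacter R h) (x : h) :
    ⁅(x : g), tmul h 1 (CharModule.one χ)⁆ = χ x • tmul h 1 (CharModule.one χ) := by
  change tmul h (UniversalEnvelopingAlgebra.ι R (x : g) * 1) (CharModule.one χ) = _
  have h1 : h.envelopingMap (UniversalEnvelopingAlgebra.ι R x) =
      UniversalEnvelopingAlgebra.ι R (x : g) := by
    simp [LieSubalgebra.envelopingMap]
  have h2 : h.envelopingAction (CharModule χ) (UniversalEnvelopingAlgebra.ι R x)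
      (CharModule.one χ) = χ x • CharModule.one χ := by
    rw [LieSubalgebra.envelopingAction, UniversalEnvelopingAlgebra.lift_ι_apply]
    rfl
  -- The balancing relation with `u = 1` and `a = ι x`.
  have h3 := (Submodule.Quotient.eq _).mpr (Submodule.subset_span
    ⟨1, UniversalEnvelopingAlgebra.ι R x, CharModule.one χ, rfl⟩ :
      _ ∈ h.balancingSubmodule (CharModule χ))
  rw [h1, h2, TensorProduct.tmul_smul, one_mul] at h3
  rw [mul_one]
  exact h3

/-- The module induced from a character is generated by `1 ⊗ 1`. -/
theorem eq_top_of_tmul_one_mem (χ : LieAlgebra.LieCharacter R h)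
    (N : Submodule R (h.InducedModule (CharModule χ))) (h1 : tmul h 1 (CharModule.one χ) ∈ N)
    (hN : ∀ x : g, ∀ v ∈ N, ⁅x, v⁆ ∈ N) : N = ⊤ := by
  have hsmul := UniversalEnvelopingAlgebra.smul_mem_of_forall_ι_smul_mem (N := N) hN
  refine Submodule.eq_top_iff'.mpr fun m => ?_
  obtain ⟨t, rfl⟩ := (h.balancingSubmodule (CharModule χ)).mkQ_surjective m
  induction t using TensorProduct.induction_on with
  | zero => exact N.zero_mem
  | tmul u r =>
    have hr : r = (show R from r) • CharModule.one χ := (mul_one (show R from r)).symm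
    rw [hr, TensorProduct.tmul_smul]
    have := N.smul_mem (show R from r) (hsmul u _ h1)
    rw [smul_tmul, mul_one] at this
    exact this
  | add s t hs ht =>
    rw [map_add]
    exact N.add_mem hs ht

end LieSubalgebra.InducedModule

end Induced

/-! ### Characters of the positive part and the conclusion. -/

namespace W22

/-- A character kills brackets, and `[L 1, W (n-1)] = (n-2) W n` with `n - 2 ≠ 0`. -/
theorem character_posW_eq_zero (φ : LieAlgebra.LieCharacter ℂ pos) {n : ℤ} (hn : 3 ≤ n)
    (hn0 : 0 < n) : φ (posW n hn0) = 0 := by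
  have h : ⁅posL 1 one_pos, posW (n - 1) (by omega)⁆ = ((n : ℂ) - 2) • posW n hn0 := by
    refine Subtype.ext ?_
    have h0 : cocycle 1 (n - 1) = 0 := if_neg (by omega)
    change ⁅L 1, W (n - 1)⁆ = ((n : ℂ) - 2) • W n
    rw [lie_L_W, h0, zero_smul, add_zero, sub_add_cancel]
    push_cast
    congr 1
    ring
  have h1 := LieAlgebra.lieCharacter_apply_lie φ (posL 1 one_pos) (posW (n - 1) (by omega))
  rw [h, map_smul, smul_eq_mul] at h1
  refine (mul_eq_zero.mp h1).resolve_left ?_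
  have : ((n : ℂ) - 2) = ((n - 2 : ℤ) : ℂ) := by push_cast; rfl
  rw [this]
  exact Int.cast_ne_zero.mpr (by omega)

theorem polyZ_smul (φ : LieAlgebra.LieCharacter ℂ pos) (p : Polynomial ℂ)
    (v : UniversalWhittaker φ) :
    polyZ p • v = Polynomial.aeval (LieModule.toEnd ℂ W22 (UniversalWhittaker φ) z) p v := by
  have h : LieModule.toEnd ℂ W22 (UniversalWhittaker φ) z =
      Algebra.lsmul ℂ ℂ (UniversalWhittaker φ) (UniversalEnvelopingAlgebra.ι ℂ z) := rfl
  rw [h, Polynomial.aeval_algHom_apply]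
  rfl

end W22

theorem proposition3p1 (φ : LieAlgebra.LieCharacter ℂ W22.pos) (hφ : W22.IsNonsingular φ)
    (w' : W22.UniversalWhittaker φ) (hw' : W22.IsWhittakerVector φ w') :
    ∃ p : Polynomial ℂ, w' = W22.polyZ p • W22.cyclicVector φ := by
  have hw := LieSubalgebra.InducedModule.lie_tmul_one W22.pos φ
  have h := W22.mem_zSpan_of_cyclic (w := W22.cyclicVector φ) (v := w')
    (μ := fun n => if hn : 0 < n then φ (W22.posW n hn) else 0)
    (ν := fun n => if hn : 0 < n then φ (W22.posL n hn) else 0)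
    (fun n hn => by simp only [dif_pos hn]; exact hw (W22.posW n hn))
    (fun n hn => by simp only [dif_pos hn]; exact hw (W22.posL n hn))
    (fun n hn => by
      have hn0 : 0 < n := by omega
      simpa only [dif_pos hn0] using W22.character_posW_eq_zero φ hn hn0)
    (right_ne_zero_of_mul hφ.2)
    (LieSubalgebra.InducedModule.eq_top_of_tmul_one_mem W22.pos φ)
    (fun n hn => by simp only [dif_pos hn]; exact hw' (W22.posW n hn))
    (fun n hn => by simp only [dif_pos hn]; exact hw' (W22.posL n hn))
  obtain ⟨p, hp⟩ := W22.mem_zSpan.mp h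
  exact ⟨p, by rw [W22.polyZ_smul, hp]⟩
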